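/- Let $d\ge 1$, $R>0$, $\delta\in(0,1)$ and $C_R=[-R/2,R/2]^d$. With $\hat f(\xi)=\int_{\mathbb R^d} f(x)e^{-2\pi i x\cdot\xi}\,dx$ (extended to $L^2(\mathbb R^d)$), let $$\mathcal B=\{f\in L^2(\mathbb R^d):\operatorname{supp}\hat f\subseteq[-1/2,1/2]^d\},\qquad \mathcal B(R,\delta)=\Big\{f\in\mathcal B:\int_{C_R}|f(x)|^2\,dx\ge(1-\delta)\|f\|_2^2\Big\};$$ functions in $\mathcal B$ are identified with their continuous representatives $f(x)=\int_{[-1/2,1/2]^d}\hat f(\xi)e^{2\pi i x\cdot\xi}\,d\xi$. Let $A_R=QP_RQ$ be the time-frequency limiting operator on $L^2(\mathbb R^d)$, where $P_Rf=\chi_{C_R}f$ and $Qf=\mathcal F^{-1}(\chi_{[-1/2,1/2]^d}\hat f)$. Let $\lambda_1\ge\lambda_2\ge\dots>0$ be the positive eigenvalues of $A_R$, repeated according to multiplicity, and let $\phi_1,\phi_2,\dots$ be an orthonormal sequence of corresponding eigenfunctions, so that for each $\mu>0$ the $\phi_j$ with $\lambda_j=\mu$ span the $\mu$-eigenspace.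 For $N\ge1$ put $\mathcal P_N=\operatorname{span}\{\phi_1,\dots,\phi_N\}$ and $\alpha=\lambda_N$. The covering index of a set $X\subseteq\mathbb R^d$ is $\max_{k\in\mathbb Z^d}\#\big(X\cap(k+[-1/2,1/2]^d)\big)$. Call $\kappa>0$ a Plancherel--Pólya constant if, for every $X\subseteq\mathbb R^d$ with finite covering index $N_0$ and every $f\in\mathcal B$, the sum $\sum_{x\in X}|f(x)|^2$ converges and is at most $\kappa N_0\|f\|_2^2$. Then $\alpha<1$, and $\kappa=e^{d\pi}$ is a Plancherel--Pólya constant. Moreover, let $\kappa$ be any Plancherel--Pólya constant (for instance $\kappa=e^{d\pi}$), let $X=\{x_1,\dots,x_r\}$ be a finite subset of $C_R$ ($x_1,\dots,x_r$ distinct) with covering index $N_0$, and let $f\in\mathcal B(R,\delta)$. Then the least squares problem $$p_{\mathrm{opt}}=\operatorname*{arg\,min}_{p\in\mathcal P_N}\ \sum_{j=1}^r|f(x_j)-p(x_j)|^2$$ has a solution, and every solution $p_{\mathrm{opt}}$ satisfies $$\sum_{j=1}^r|f(x_j)-p_{\mathrm{opt}}(x_j)|^2\le N_0\,\kappa\,\frac{\delta}{1-\alpha}\,\|f\|_2^2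 .$$ -/

import Mathlib

open MeasureTheory
open scoped FourierTransform ENNReal

noncomputable section

namespace RelevantSampling

/-- Euclidean space `ℝ^d`. -/
abbrev Space (d : ℕ) : Type := EuclideanSpace ℝ (Fin d)

/-- The complex Hilbert space `L²(ℝ^d)` (Lebesgue measure). -/
abbrev L2 (d : ℕ) : Type := Lp (α := Space d) ℂ 2

/-- The closed cube `[-R/2, R/2]^d`; in particular `cube d 1 = [-1/2, 1/2]^d`. -/
def cube (d : ℕ) (R : ℝ) : Set (Space d) := {x | ∀ i, x i ∈ Set.Icc (-(R / 2)) (R / 2)}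

theorem measurableSet_cube (d : ℕ) (R : ℝ) : MeasurableSet (cube d R) := by
  have h : cube d R = ⋂ i, (fun x : Space d => x i) ⁻¹' Set.Icc (-(R / 2)) (R / 2) := by
    ext x; simp [cube]
  rw [h]
  refine MeasurableSet.iInter fun i => ?_
  have hi : Measurable (fun x : Space d => x i) := by fun_prop
  exact hi measurableSet_Icc

/-- Multiplication by the characteristic function of a measurable set `S`, as a linear map on
`L²(ℝ^d)`. -/
def cutoffₗ {d : ℕ} (S : Set (Space d)) (hS : MeasurableSet S) : L2 d →ₗ[ℂ] L2 d where
  toFun f := ((Lp.memLp f).indicator hS).toLp (S.indicator f)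
  map_add' f g := by
    rw [← MemLp.toLp_add]
    refine MemLp.toLp_congr _ _ ?_
    filter_upwards [Lp.coeFn_add f g] with x hx
    rw [← Set.indicator_add']
    by_cases h : x ∈ S
    · rw [Set.indicator_of_mem h, Set.indicator_of_mem h, hx]
    · rw [Set.indicator_of_notMem h, Set.indicator_of_notMem h]
  map_smul' c f := by
    rw [RingHom.id_apply, ← MemLp.toLp_const_smul]
    refine MemLp.toLp_congr _ _ ?_
    filter_upwards [Lp.coeFn_smul c f] with x hx
    rw [Pi.smul_apply]
    by_cases h : x ∈ S
    · rw [Set.indicator_of_mem h, Set.indicator_of_mem h, hx, Pi.smul_apply]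
    · rw [Set.indicator_of_notMem h, Set.indicator_of_notMem h, smul_zero]

theorem cutoffₗ_ae {d : ℕ} (S : Set (Space d)) (hS : MeasurableSet S) (f : L2 d) :
    ∀ᵐ x : Space d, (cutoffₗ S hS f : L2 d) x = S.indicator (fun y => f y) x := by
  have h : cutoffₗ S hS f = ((Lp.memLp f).indicator hS).toLp (S.indicator f) := rfl
  rw [h]
  exact MemLp.coeFn_toLp _

theorem norm_cutoffₗ_le {d : ℕ} (S : Set (Space d)) (hS : MeasurableSet S) (f : L2 d) :
    ‖cutoffₗ S hS f‖ ≤ 1 * ‖f‖ := by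
  rw [one_mul]
  refine Lp.norm_le_norm_of_ae_le ?_
  filter_upwards [cutoffₗ_ae S hS f] with x hx
  rw [hx]
  exact norm_indicator_le_norm_self _ _

/-- Multiplication by the characteristic function of `S`, as a bounded operator on `L²(ℝ^d)`. -/
def cutoff {d : ℕ} (S : Set (Space d)) (hS : MeasurableSet S) : L2 d →L[ℂ] L2 d :=
  (cutoffₗ S hS).mkContinuous 1 (norm_cutoffₗ_le S hS)

/-- The spatial projection `P_R f = χ_{C_R} f`, with `C_R = [-R/2, R/2]^d`. -/
def timeLimit (d : ℕ) (R : ℝ) : L2 d →L[ℂ] L2 d :=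
  cutoff (cube d R) (measurableSet_cube d R)

/-- The spectral projection `Q f = 𝓕⁻¹ (χ_{[-1/2,1/2]^d} 𝓕 f)`. -/
def bandLimit (d : ℕ) : L2 d →L[ℂ] L2 d :=
  ((Lp.fourierTransformₗᵢ (Space d) ℂ).symm.toContinuousLinearEquiv : L2 d →L[ℂ] L2 d) ∘L
    cutoff (cube d 1) (measurableSet_cube d 1) ∘L
    ((Lp.fourierTransformₗᵢ (Space d) ℂ).toContinuousLinearEquiv : L2 d →L[ℂ] L2 d)

/-- The operator of time and frequency limiting, `A_R = Q P_R Q`. -/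
def timeFreqLimit (d : ℕ) (R : ℝ) : L2 d →L[ℂ] L2 d :=
  bandLimit d ∘L timeLimit d R ∘L bandLimit d

/-- The space of band-limited functions,
`{f ∈ L²(ℝ^d) : supp 𝓕 f ⊆ [-1/2, 1/2]^d}`. -/
def bandlimited (d : ℕ) : Submodule ℂ (L2 d) where
  carrier := {f | ∀ᵐ ξ : Space d, ξ ∉ cube d 1 → (𝓕 f : L2 d) ξ = 0}
  zero_mem' := by
    have h : (𝓕 (0 : L2 d) : L2 d) = 0 := (Lp.fourierTransformₗᵢ (Space d) ℂ).map_zero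
    simp only [Set.mem_ofPred_eq, h]
    filter_upwards [Lp.coeFn_zero ℂ 2 (volume : Measure (Space d))] with ξ hξ _
    rw [hξ]; rfl
  add_mem' := by
    intro f g hf hg
    have h : (𝓕 (f + g) : L2 d) = 𝓕 f + 𝓕 g :=
      (Lp.fourierTransformₗᵢ (Space d) ℂ).map_add f g
    simp only [Set.mem_ofPred_eq, h] at *
    filter_upwards [hf, hg, Lp.coeFn_add (𝓕 f : L2 d) (𝓕 g)] with ξ h1 h2 h3 h4
    rw [h3, Pi.add_apply, h1 h4, h2 h4, add_zero]
  smul_mem' := by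
    intro c f hf
    have h : (𝓕 (c • f) : L2 d) = c • 𝓕 f :=
      (Lp.fourierTransformₗᵢ (Space d) ℂ).map_smul c f
    simp only [Set.mem_ofPred_eq, h] at *
    filter_upwards [hf, Lp.coeFn_smul c (𝓕 f : L2 d)] with ξ h1 h3 h4
    rw [h3, Pi.smul_apply, h1 h4, smul_zero]

/-- `B(R, δ)`: the band-limited `f` with `∫_{C_R} |f|² ≥ (1 - δ) ‖f‖₂²`. -/
def essSupported (d : ℕ) (R δ : ℝ) : Set (L2 d) :=
  {f | f ∈ bandlimited d ∧ (1 - δ) * ‖f‖ ^ 2 ≤ ∫ x in cube d R, ‖f x‖ ^ 2}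

/-- The value at the point `x` of (the continuous representative of) a band-limited `f`, given by
the inversion formula `f(x) = ∫ e^{2πi x·ξ} 𝓕 f(ξ) dξ`; the integral converges absolutely since
`𝓕 f` is square integrable and vanishes outside a cube. -/
def value {d : ℕ} (f : L2 d) (x : Space d) : ℂ := 𝓕⁻ (⇑(𝓕 f : L2 d) : Space d → ℂ) x

/-- `lam 0 ≥ lam 1 ≥ ⋯ > 0` lists the positive eigenvalues of `A_R`, each repeated according to
its multiplicity, and `φ 0, φ 1, …` is an orthonormal sequence of corresponding eigenfunctions.
The numbering starts at `0`, so that `lam (N - 1)` is the `N`-th eigenvalue. -/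
structure IsProlateSystem (d : ℕ) (R : ℝ) (lam : ℕ → ℝ) (φ : ℕ → L2 d) : Prop where
  antitone : Antitone lam
  pos : ∀ j, 0 < lam j
  orthonormal : Orthonormal ℂ φ
  eigen : ∀ j, timeFreqLimit d R (φ j) = (lam j : ℂ) • φ j
  exhaustive : ∀ μ : ℝ, 0 < μ →
    Module.End.eigenspace (timeFreqLimit d R : L2 d →ₗ[ℂ] L2 d) (μ : ℂ) ≤
      Submodule.span ℂ (φ '' {j | lam j = μ})

/-- `P_N`, the span of the first `N` eigenfunctions. -/
def prolateSpan {d : ℕ} (φ : ℕ → L2 d) (N : ℕ) : Submodule ℂ (L2 d) :=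
  Submodule.span ℂ (φ '' {j | j < N})

/-- The cube `k + [-1/2, 1/2]^d`, for `k ∈ ℤ^d`. -/
def latticeCube {d : ℕ} (k : Fin d → ℤ) : Set (Space d) :=
  {x | ∀ i, x i - (k i : ℝ) ∈ Set.Icc (-(1 / 2) : ℝ) (1 / 2)}

/-- The covering index `max_{k ∈ ℤ^d} #(X ∩ (k + [-1/2, 1/2]^d))`, possibly infinite. -/
def coveringIndex {d : ℕ} (X : Set (Space d)) : ℕ∞ :=
  ⨆ k : Fin d → ℤ, (X ∩ latticeCube k).encard

/-- `κ` is a constant in the Plancherel–Pólya inequality: `∑_{x ∈ X} |f(x)|² ≤ κ N₀ ‖f‖₂²` for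
every set `X ⊆ ℝ^d` of finite covering index `N₀` and every band-limited `f`. -/
def IsPlancherelPolyaConst (d : ℕ) (κ : ℝ) : Prop :=
  0 < κ ∧ ∀ (X : Set (Space d)) (N₀ : ℕ), coveringIndex X = N₀ → ∀ f ∈ bandlimited d,
    Summable (fun x : X => ‖value f x‖ ^ 2) ∧
      ∑' x : X, ‖value f x‖ ^ 2 ≤ κ * N₀ * ‖f‖ ^ 2

/-- The sampled squared error `∑_{x ∈ X} |f(x) - p(x)|²`. -/
def sampledError {d : ℕ} (X : Finset (Space d)) (f p : L2 d) : ℝ :=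
  ∑ x ∈ X, ‖value f x - value p x‖ ^ 2

/-- `p` solves the least squares problem `argmin_{q ∈ V} ∑_{x ∈ X} |f(x) - q(x)|²`. -/
def IsLeastSquaresFit {d : ℕ} (V : Submodule ℂ (L2 d)) (X : Finset (Space d)) (f p : L2 d) :
    Prop :=
  p ∈ V ∧ ∀ q ∈ V, sampledError X f p ≤ sampledError X f q

end RelevantSampling

end

/-! The least squares error is at most the sampled error of any competitor, in particular of the
orthogonal projection `p` of `f` onto the first `N` eigenfunctions. With `g = f - p`,
Plancherel–Pólya bounds that error by `κ N₀ ‖g‖²`, so it remains to estimate `‖g‖`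
(`norm_sub_starProjection_sq_le`).

The form `⟨f, A_R f⟩` is the energy of `f` in the cube, hence at least `(1 - δ)‖f‖²`. Since `A_R` is
symmetric and preserves `P_N`, it also splits as `⟨p, A_R p⟩ + ⟨g, A_R g⟩ ≤ ‖p‖² + α‖g‖²`. Comparing
with `‖f‖² = ‖p‖² + ‖g‖²` gives `(1 - α)‖g‖² ≤ δ‖f‖²`. The bound on `⟨g, A_R g⟩` needs `A_R` to be
compact: on `P_Nᗮ` its norm is then controlled by its eigenvalues there, and an eigenvalue above `α`
has all its eigenvectors in `P_N`.

The remaining facts come from one Taylor expansion of the inversion integral, `hasSum_taylorTerm`.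
Along lines it makes band-limited functions power series, so none but zero is supported in a cube,
which gives `α < 1`. Truncated at the origin it approximates `P_R Q` in norm by finite rank
operators, which gives compactness. Expanded about nearest lattice points, with Bessel's inequality
for the integer exponentials on the unit cube, it gives the constant `e^{dπ}`. -/

namespace RelevantSampling

/-! ### Compact self-adjoint operators and their eigenvalues -/

section Spectral

variable {E : Type*} [NormedAddCommGroup E] [InnerProductSpace ℂ E]

/-- A compact self-adjoint operator all of whose eigenvalues have modulus at most `a` has norm at
most `a`. -/
theorem opNorm_le_of_eigenvalue_le [CompleteSpace E] {T : E →L[ℂ] E} (hT : IsCompactOperator T)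
    (hs : (T : E →ₗ[ℂ] E).IsSymmetric) {a : ℝ} (ha : 0 ≤ a)
    (h : ∀ (μ : ℂ) (x : E), x ≠ 0 → T x = μ • x → ‖μ‖ ≤ a) : ‖T‖ ≤ a := by
  lift a to NNReal using ha
  -- The nonzero spectrum of a compact operator consists of eigenvalues, and the spectral radius of
  -- a self-adjoint operator is its norm.
  have hr : spectralRadius ℂ T ≤ a := by
    refine iSup₂_le fun μ hμ => ?_
    by_cases h0 : μ = 0
    · simp [h0]
    · obtain ⟨v, hv⟩ := ((hT.hasEigenvalue_iff_mem_spectrum h0).2 hμ).exists_hasEigenvector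
      have := h μ v hv.2 hv.apply_eq_smul
      exact_mod_cast this
  rw [T.spectralRadius_eq_nnnorm (ContinuousLinearMap.isSelfAdjoint_iff_isSymmetric.2 hs)] at hr
  exact_mod_cast hr

/-- The quadratic form of a compact self-adjoint operator on an invariant closed subspace is bounded
by the eigenvalues with eigenvectors in this subspace. -/
theorem norm_inner_le_of_eigenvalue_le {T : E →L[ℂ] E} (hT : IsCompactOperator T)
    (hs : (T : E →ₗ[ℂ] E).IsSymmetric) (V : Submodule ℂ E) [CompleteSpace V]
    (hV : ∀ x ∈ V, T x ∈ V) {a : ℝ} (ha : 0 ≤ a)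
    (h : ∀ (μ : ℂ), ∀ x ∈ V, x ≠ 0 → T x = μ • x → ‖μ‖ ≤ a) {x : E} (hx : x ∈ V) :
    ‖inner ℂ x (T x)‖ ≤ a * ‖x‖ ^ 2 := by
  have hS := opNorm_le_of_eigenvalue_le (T := T.restrict hV) (hT.restrict' hV)
    (hs.restrict_invariant hV) ha (fun μ y hy0 hy => h μ y y.2 (by simpa using hy0) (by
      have := congrArg (Subtype.val) hy
      simpa using this))
  calc ‖inner ℂ x (T x)‖ ≤ ‖x‖ * ‖T x‖ := norm_inner_le_norm _ _
    _ ≤ ‖x‖ * (a * ‖x‖) := by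
      gcongr
      exact (T.restrict hV).le_of_opNorm_le hS ⟨x, hx⟩
    _ = a * ‖x‖ ^ 2 := by ring

end Spectral

/-! ### Time limiting, band limiting and their composition -/

section Operators

variable {d : ℕ}

theorem cutoff_ae (S : Set (Space d)) (hS : MeasurableSet S) (f : L2 d) :
    cutoff S hS f =ᵐ[volume] S.indicator f := cutoffₗ_ae S hS f

theorem inner_cutoff_left (S : Set (Space d)) (hS : MeasurableSet S) (f g : L2 d) :
    inner ℂ (cutoff S hS f) g = inner ℂ f (cutoff S hS g) := by
  rw [L2.inner_def, L2.inner_def]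
  refine integral_congr_ae ?_
  filter_upwards [cutoff_ae S hS f, cutoff_ae S hS g] with x hf hg
  rw [hf, hg]
  by_cases h : x ∈ S <;> simp [h]

theorem cutoff_cutoff (S : Set (Space d)) (hS : MeasurableSet S) (f : L2 d) :
    cutoff S hS (cutoff S hS f) = cutoff S hS f := by
  refine Lp.ext ?_
  filter_upwards [cutoff_ae S hS f, cutoff_ae S hS (cutoff S hS f)] with x hf hg
  rw [hg]
  by_cases h : x ∈ S
  · simp [h]
  · simp [h, hf]

theorem norm_cutoff_le (S : Set (Space d)) (hS : MeasurableSet S) (f : L2 d) :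
    ‖cutoff S hS f‖ ≤ ‖f‖ :=
  (norm_cutoffₗ_le S hS f).trans_eq (one_mul _)

theorem norm_sq_eq_integral (f : L2 d) : ‖f‖ ^ 2 = ∫ x, ‖f x‖ ^ 2 := by
  have h := inner_self_eq_norm_sq (𝕜 := ℂ) f
  rw [← h, L2.inner_def, ← integral_re (L2.integrable_inner f f)]
  simp only [inner_self_eq_norm_sq]

theorem norm_cutoff_sq (S : Set (Space d)) (hS : MeasurableSet S) (f : L2 d) :
    ‖cutoff S hS f‖ ^ 2 = ∫ x in S, ‖f x‖ ^ 2 := by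
  rw [norm_sq_eq_integral, ← integral_indicator hS]
  refine integral_congr_ae ?_
  filter_upwards [cutoff_ae S hS f] with x hf
  rw [hf]
  by_cases h : x ∈ S <;> simp [h]

theorem fourier_bandLimit (f : L2 d) :
    (𝓕 (bandLimit d f) : L2 d) = cutoff (cube d 1) (measurableSet_cube d 1) (𝓕 f : L2 d) :=
  (Lp.fourierTransformₗᵢ (Space d) ℂ).apply_symm_apply _

theorem bandLimit_mem (f : L2 d) : bandLimit d f ∈ bandlimited d := by
  change ∀ᵐ ξ : Space d, ξ ∉ cube d 1 → (𝓕 (bandLimit d f) : L2 d) ξ = 0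
  rw [fourier_bandLimit]
  filter_upwards [cutoff_ae (cube d 1) (measurableSet_cube d 1) (𝓕 f : L2 d)] with ξ h h0
  rw [h, Set.indicator_of_notMem h0]

theorem bandLimit_eq_self {f : L2 d} (hf : f ∈ bandlimited d) : bandLimit d f = f := by
  refine (Lp.fourierTransformₗᵢ (Space d) ℂ).injective ?_
  change (𝓕 (bandLimit d f) : L2 d) = (𝓕 f : L2 d)
  rw [fourier_bandLimit]
  refine Lp.ext ?_
  have hf' : ∀ᵐ ξ : Space d, ξ ∉ cube d 1 → (𝓕 f : L2 d) ξ = 0 := hf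
  filter_upwards [cutoff_ae (cube d 1) (measurableSet_cube d 1) (𝓕 f : L2 d), hf'] with ξ h h0
  rw [h]
  by_cases hξ : ξ ∈ cube d 1
  · simp [hξ]
  · simp [hξ, h0 hξ]

theorem inner_bandLimit_left (f g : L2 d) :
    inner ℂ (bandLimit d f) g = inner ℂ f (bandLimit d g) := by
  rw [← Lp.inner_fourier_eq, ← Lp.inner_fourier_eq f, fourier_bandLimit, fourier_bandLimit,
    inner_cutoff_left]

theorem norm_bandLimit_le (f : L2 d) : ‖bandLimit d f‖ ≤ ‖f‖ := by
  rw [← Lp.norm_fourier_eq, ← Lp.norm_fourier_eq f, fourier_bandLimit]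
  exact norm_cutoff_le _ _ _

theorem timeFreqLimit_isSymmetric (d : ℕ) (R : ℝ) :
    (timeFreqLimit d R : L2 d →ₗ[ℂ] L2 d).IsSymmetric := fun f g => by
  change inner ℂ (bandLimit d (timeLimit d R (bandLimit d f))) g
    = inner ℂ f (bandLimit d (timeLimit d R (bandLimit d g)))
  rw [inner_bandLimit_left, timeLimit, inner_cutoff_left, inner_bandLimit_left]

/-- `Q` fixes `f` and `P_R` is a symmetric idempotent. Through this identity the concentration
hypothesis becomes a statement about the quadratic form of `A_R`. -/
theorem inner_timeFreqLimit_self {R : ℝ} {f : L2 d} (hf : f ∈ bandlimited d) :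
    inner ℂ f (timeFreqLimit d R f) = ((‖timeLimit d R f‖ ^ 2 : ℝ) : ℂ) := by
  change inner ℂ f (bandLimit d (timeLimit d R (bandLimit d f))) = _
  rw [← inner_bandLimit_left, bandLimit_eq_self hf, timeLimit, ← cutoff_cutoff,
    ← inner_cutoff_left, inner_self_eq_norm_sq_to_K, cutoff_cutoff]
  simp

theorem timeFreqLimit_mem (R : ℝ) (f : L2 d) : timeFreqLimit d R f ∈ bandlimited d :=
  bandLimit_mem _

end Operators

/-! ### Taylor expansion of an inverse Fourier integral -/

section Taylor

variable {d : ℕ}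

theorem abs_le_of_mem_cube {R : ℝ} {x : Space d} (hx : x ∈ cube d R) (i : Fin d) :
    |x i| ≤ R / 2 := abs_le.2 (hx i)

theorem abs_inner_le_of_mem_cube {ρ : ℝ} {ξ t : Space d} (hξ : ξ ∈ cube d 1)
    (ht : t ∈ cube d ρ) : |inner ℝ ξ t| ≤ d * ρ / 4 := by
  rw [PiLp.inner_apply]
  calc |∑ i, inner ℝ (ξ i) (t i)| ≤ ∑ i, |inner ℝ (ξ i) (t i)| := Finset.abs_sum_le_sum_abs _ _
    _ ≤ ∑ _i : Fin d, (1 / 2) * (ρ / 2) := by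
      refine Finset.sum_le_sum fun i _ => ?_
      rw [real_inner_eq_re_inner, RCLike.inner_apply, conj_trivial, RCLike.re_to_real, abs_mul,
        mul_comm]
      have h1 := abs_le_of_mem_cube hξ i
      have h2 := abs_le_of_mem_cube ht i
      gcongr
    _ = d * ρ / 4 := by
      rw [Finset.sum_const, Finset.card_univ, Fintype.card_fin, nsmul_eq_mul]; ring

/-- The `n`-th Taylor coefficient at `x`, in the direction `t`, of `y ↦ ∫ F(ξ) e^{2πi y·ξ} dξ`. -/
noncomputable def taylorTerm (F : Space d → ℂ) (x t : Space d) (n : ℕ) : ℂ :=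
  (2 * Real.pi * Complex.I) ^ n / n.factorial *
    ∫ ξ, ((inner ℝ ξ t : ℝ) : ℂ) ^ n * (Complex.exp (2 * Real.pi * inner ℝ ξ x * Complex.I) * F ξ)

theorem fourierInv_eq_integral (F : Space d → ℂ) (x : Space d) :
    𝓕⁻ F x = ∫ ξ, Complex.exp (2 * Real.pi * inner ℝ ξ x * Complex.I) * F ξ := by
  rw [Real.fourierInv_eq']
  refine integral_congr_ae (Filter.Eventually.of_forall fun ξ => ?_)
  simp only [smul_eq_mul]
  congr 2
  push_cast
  ring

theorem norm_exp_inner (ξ x : Space d) :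
    ‖Complex.exp (2 * Real.pi * inner ℝ ξ x * Complex.I)‖ = 1 := by
  have : (2 * Real.pi * inner ℝ ξ x * Complex.I : ℂ)
      = ((2 * Real.pi * inner ℝ ξ x : ℝ) : ℂ) * Complex.I := by push_cast; ring
  rw [this, Complex.norm_exp_ofReal_mul_I]

theorem integrable_exp_mul {F : Space d → ℂ} (hF : Integrable F) (x : Space d) :
    Integrable fun ξ => Complex.exp (2 * Real.pi * inner ℝ ξ x * Complex.I) * F ξ := by
  refine hF.bdd_mul (c := 1) ?_ (Filter.Eventually.of_forall fun ξ => (norm_exp_inner ξ x).le)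
  exact Continuous.aestronglyMeasurable (by fun_prop)

theorem norm_inner_pow_mul_le {F : Space d → ℂ} {c : ℝ} (x t : Space d)
    (n : ℕ) {ξ : Space d} (hξ : F ξ ≠ 0 → |inner ℝ ξ t| ≤ c) :
    ‖((inner ℝ ξ t : ℝ) : ℂ) ^ n * (Complex.exp (2 * Real.pi * inner ℝ ξ x * Complex.I) * F ξ)‖
      ≤ c ^ n * ‖F ξ‖ := by
  rw [norm_mul, norm_mul, norm_exp_inner, one_mul, norm_pow, Complex.norm_real, Real.norm_eq_abs]
  by_cases h : F ξ = 0
  · simp [h]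
  · gcongr
    exact hξ h

theorem integrable_inner_pow_mul {F : Space d → ℂ} (hF : Integrable F) {c : ℝ} (x t : Space d)
    (hc : ∀ᵐ ξ, F ξ ≠ 0 → |inner ℝ ξ t| ≤ c) (n : ℕ) :
    Integrable fun ξ => ((inner ℝ ξ t : ℝ) : ℂ) ^ n *
      (Complex.exp (2 * Real.pi * inner ℝ ξ x * Complex.I) * F ξ) := by
  refine (hF.norm.const_mul (c ^ n)).mono' ?_ ?_
  · refine AEStronglyMeasurable.mul ?_ (integrable_exp_mul hF x).aestronglyMeasurable
    exact Continuous.aestronglyMeasurable (by fun_prop)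
  · filter_upwards [hc] with ξ hξ
    exact norm_inner_pow_mul_le x t n hξ

theorem norm_two_pi_I_pow_div_factorial (n : ℕ) :
    ‖(2 * Real.pi * Complex.I) ^ n / (n.factorial : ℂ)‖ = (2 * Real.pi) ^ n / n.factorial := by
  rw [norm_div, norm_pow, norm_mul, norm_mul, Complex.norm_I, Complex.norm_natCast,
    Complex.norm_real, Real.norm_of_nonneg Real.pi_pos.le]
  simp

theorem integral_norm_inner_pow_mul_le {F : Space d → ℂ} (hF : Integrable F) {c : ℝ}
    (x t : Space d) (hc : ∀ᵐ ξ, F ξ ≠ 0 → |inner ℝ ξ t| ≤ c) (n : ℕ) :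
    ∫ ξ, ‖(2 * Real.pi * Complex.I) ^ n / (n.factorial : ℂ) * (((inner ℝ ξ t : ℝ) : ℂ) ^ n *
      (Complex.exp (2 * Real.pi * inner ℝ ξ x * Complex.I) * F ξ))‖
      ≤ (2 * Real.pi * c) ^ n / n.factorial * ∫ ξ, ‖F ξ‖ := by
  rw [← integral_const_mul]
  refine integral_mono_ae ((integrable_inner_pow_mul hF x t hc n).const_mul _).norm
    (hF.norm.const_mul _) ?_
  filter_upwards [hc] with ξ hξ
  rw [norm_mul, norm_two_pi_I_pow_div_factorial]
  calc _ ≤ (2 * Real.pi) ^ n / n.factorial * (c ^ n * ‖F ξ‖) := by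
        gcongr
        exact norm_inner_pow_mul_le x t n hξ
    _ = _ := by rw [mul_pow]; ring

theorem norm_taylorTerm_le {F : Space d → ℂ} (hF : Integrable F) {c : ℝ}
    (x t : Space d) (hc : ∀ᵐ ξ, F ξ ≠ 0 → |inner ℝ ξ t| ≤ c) (n : ℕ) :
    ‖taylorTerm F x t n‖ ≤ (2 * Real.pi * c) ^ n / n.factorial * ∫ ξ, ‖F ξ‖ := by
  rw [taylorTerm, ← integral_const_mul]
  exact (norm_integral_le_integral_norm _).trans (integral_norm_inner_pow_mul_le hF x t hc n)

/-- The Taylor expansion of the inverse Fourier transform of a function with bounded support. -/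
theorem hasSum_taylorTerm {F : Space d → ℂ} (hF : Integrable F) {c : ℝ}
    (x t : Space d) (hc : ∀ᵐ ξ, F ξ ≠ 0 → |inner ℝ ξ t| ≤ c) :
    HasSum (taylorTerm F x t) (𝓕⁻ F (x + t)) := by
  -- Sum and integral are interchanged in the exponential series of `2πi ξ·t`; the integrals of the
  -- norms are dominated by `(2πc)^n / n!` times the `L¹` norm of `F`.
  have h := hasSum_integral_of_summable_integral_norm (μ := (volume : Measure (Space d)))
    (F := fun (n : ℕ) ξ => (2 * Real.pi * Complex.I) ^ n / (n.factorial : ℂ) *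
      (((inner ℝ ξ t : ℝ) : ℂ) ^ n *
      (Complex.exp (2 * Real.pi * inner ℝ ξ x * Complex.I) * F ξ)))
    (fun n => (integrable_inner_pow_mul hF x t hc n).const_mul _)
    (Summable.of_nonneg_of_le (fun n => by positivity)
      (fun n => integral_norm_inner_pow_mul_le hF x t hc n)
      ((Real.summable_pow_div_factorial _).mul_right _))
  rw [fourierInv_eq_integral]
  have hterm : taylorTerm F x t = fun n => _ :=
    funext fun n => (integral_const_mul _ _).symm
  rw [hterm]
  refine Eq.subst (motive := fun z => HasSum _ z) (integral_congr_ae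
    (Filter.Eventually.of_forall fun ξ => ?_)) h
  have hs := (NormedSpace.expSeries_div_hasSum_exp (2 * Real.pi * Complex.I * inner ℝ ξ t))
  rw [← Complex.exp_eq_exp_ℂ] at hs
  have hs' := hs.mul_right (Complex.exp (2 * Real.pi * inner ℝ ξ x * Complex.I) * F ξ)
  rw [← mul_assoc, ← Complex.exp_add] at hs'
  refine Eq.trans ((tsum_congr fun n => ?_).trans hs'.tsum_eq) ?_
  · rw [mul_pow]; ring
  · simp only
    congr 2
    rw [inner_add_right]
    push_cast
    ring

end Taylor

/-! ### Continuous representatives and unique continuation -/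

section Value

variable {d : ℕ}

theorem volume_cube (d : ℕ) (R : ℝ) : volume (cube d R) = ENNReal.ofReal R ^ d := by
  have h : cube d R = (MeasurableEquiv.toLp 2 (Fin d → ℝ)).symm ⁻¹'
      Set.Icc (fun _ => -(R / 2)) (fun _ => R / 2) := by
    ext x
    simp only [cube, Set.mem_Icc, Set.mem_preimage, Pi.le_def]
    exact forall_and
  rw [h, (EuclideanSpace.volume_preserving_symm_measurableEquiv_toLp (Fin d)).measure_preimage
    measurableSet_Icc.nullMeasurableSet, Real.volume_Icc_pi]
  simp

instance isProbabilityMeasure_restrict_cube (d : ℕ) :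
    IsProbabilityMeasure ((volume : Measure (Space d)).restrict (cube d 1)) :=
  ⟨by simp [volume_cube]⟩

/-- Square integrable functions that vanish outside the unit cube are integrable. -/
theorem integrable_of_vanishing {g : L2 d} (hg : ∀ᵐ ξ, ξ ∉ cube d 1 → g ξ = 0) :
    Integrable g := by
  have h : IntegrableOn g (cube d 1) :=
    ((Lp.memLp g).mono_measure Measure.restrict_le_self).integrable one_le_two
  exact h.integrable_of_ae_notMem_eq_zero hg

/-- The unit cube has measure one, so the `L¹` norm there is at most the `L²` norm, without a
constant. -/
theorem integral_norm_le_of_vanishing {g : L2 d} (hg : ∀ᵐ ξ, ξ ∉ cube d 1 → g ξ = 0) :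
    ∫ ξ, ‖g ξ‖ ≤ ‖g‖ := by
  have h0 : ∫ ξ, ‖g ξ‖ = ∫ ξ in cube d 1, ‖g ξ‖ := by
    refine (setIntegral_eq_integral_of_ae_compl_eq_zero ?_).symm
    filter_upwards [hg] with ξ h hξ
    rw [h hξ, norm_zero]
  have hm : AEStronglyMeasurable g (volume.restrict (cube d 1)) :=
    (Lp.aestronglyMeasurable g).restrict
  rw [h0, integral_norm_eq_lintegral_enorm hm, ← eLpNorm_one_eq_lintegral_enorm, Lp.norm_def]
  refine ENNReal.toReal_mono (Lp.eLpNorm_ne_top g) ?_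
  exact (eLpNorm_le_eLpNorm_of_exponent_le one_le_two hm).trans
    (eLpNorm_mono_measure _ Measure.restrict_le_self)

theorem integrable_fourier {f : L2 d} (hf : f ∈ bandlimited d) : Integrable (𝓕 f : L2 d) :=
  integrable_of_vanishing hf

theorem integral_norm_fourier_le {f : L2 d} (hf : f ∈ bandlimited d) :
    ∫ ξ, ‖(𝓕 f : L2 d) ξ‖ ≤ ‖f‖ :=
  (integral_norm_le_of_vanishing hf).trans_eq (Lp.norm_fourier_eq f)

theorem value_eq_integral (f : L2 d) (x : Space d) :
    value f x =
      ∫ ξ, Complex.exp (2 * Real.pi * inner ℝ ξ x * Complex.I) * (𝓕 f : L2 d) ξ :=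
  fourierInv_eq_integral _ x

theorem continuous_neg_innerₗ :
    Continuous fun p : Space d × Space d => (-innerₗ (Space d)) p.1 p.2 :=
  (continuous_inner (𝕜 := ℝ) (E := Space d)).neg

/-- The pairing is minus the inner product, which turns the general Fourier integral into the
inverse transform. -/
theorem continuous_value {f : L2 d} (hf : f ∈ bandlimited d) : Continuous (value f) :=
  VectorFourier.fourierIntegral_continuous (L := -innerₗ (Space d)) Real.continuous_fourierChar
    continuous_neg_innerₗ (integrable_fourier hf)

theorem value_sub {f g : L2 d} (hf : f ∈ bandlimited d) (hg : g ∈ bandlimited d) (x : Space d) :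
    value (f - g) x = value f x - value g x := by
  simp only [value_eq_integral]
  rw [← integral_sub (integrable_exp_mul (integrable_fourier hf) x)
    (integrable_exp_mul (integrable_fourier hg) x)]
  refine integral_congr_ae ?_
  have h : (𝓕 (f - g) : L2 d) = 𝓕 f - 𝓕 g := (Lp.fourierTransformₗᵢ (Space d) ℂ).map_sub f g
  rw [h]
  filter_upwards [Lp.coeFn_sub (𝓕 f : L2 d) (𝓕 g)] with ξ hξ
  rw [hξ, Pi.sub_apply, mul_sub]

theorem value_add {f g : L2 d} (hf : f ∈ bandlimited d) (hg : g ∈ bandlimited d) (x : Space d) :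
    value (f + g) x = value f x + value g x := by
  have h := value_sub ((bandlimited d).add_mem hf hg) hg x
  rw [add_sub_cancel_right] at h
  rw [h, sub_add_cancel]

theorem value_smul (c : ℂ) (f : L2 d) (x : Space d) : value (c • f) x = c * value f x := by
  simp only [value_eq_integral]
  rw [← integral_const_mul]
  refine integral_congr_ae ?_
  have h : (𝓕 (c • f) : L2 d) = c • 𝓕 f := (Lp.fourierTransformₗᵢ (Space d) ℂ).map_smul c f
  rw [h]
  filter_upwards [Lp.coeFn_smul c (𝓕 f : L2 d)] with ξ hξ
  rw [hξ, Pi.smul_apply, smul_eq_mul]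
  ring

/-- A band-limited function agrees almost everywhere with its continuous representative. -/
theorem ae_eq_value {f : L2 d} (hf : f ∈ bandlimited d) : f =ᵐ[volume] value f := by
  refine ae_eq_of_integral_contDiff_smul_eq ((Lp.memLp f).locallyIntegrable one_le_two)
    (continuous_value hf).locallyIntegrable fun g hg hgc => ?_
  have hg₁ : HasCompactSupport (Complex.ofRealCLM ∘ g) := hgc.comp_left rfl
  have hg₂ : ContDiff ℝ (⊤ : ℕ∞) (Complex.ofRealCLM ∘ g) := by fun_prop
  set G : SchwartzMap (Space d) ℂ := hg₁.toSchwartzMap hg₂ with hG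
  have hGg : ∀ x, G x = (g x : ℂ) := fun x => rfl
  calc ∫ x, g x • f x = ∫ x, G x • f x := by
        refine integral_congr_ae (Filter.Eventually.of_forall fun x => ?_)
        simp [hGg]
    -- Fourier inversion on `L²`, read as an identity of tempered distributions; the next equality
    -- is the classical transfer formula for the integrable functions `G` and `𝓕 f`.
    _ = ∫ ξ, (𝓕⁻ G) ξ • (𝓕 f : L2 d) ξ := by
        rw [← Lp.toTemperedDistribution_apply, ← Lp.toTemperedDistribution_apply,
          ← TemperedDistribution.fourierInv_apply, Lp.fourierInv_toTemperedDistribution_eq,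
          FourierTransform.fourierInv_fourier_eq]
    _ = ∫ x, G x • value f x := by
        rw [SchwartzMap.fourierInv_coe]
        have := VectorFourier.integral_fourierIntegral_smul_eq_flip (L := -innerₗ (Space d))
          (μ := volume) (ν := volume) Real.continuous_fourierChar
          continuous_neg_innerₗ
          G.integrable (integrable_fourier hf)
        have hflip : (-innerₗ (Space d)).flip = -innerₗ (Space d) := by
          ext x y; simp [real_inner_comm]
        rw [hflip] at this
        exact this
    _ = ∫ x, g x • value f x := by
        refine integral_congr_ae (Filter.Eventually.of_forall fun x => ?_)
        simp [hGg]

theorem ae_abs_inner_le {f : L2 d} (hf : f ∈ bandlimited d) {ρ : ℝ} {t : Space d}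
    (ht : t ∈ cube d ρ) : ∀ᵐ ξ, (𝓕 f : L2 d) ξ ≠ 0 → |inner ℝ ξ t| ≤ d * ρ / 4 := by
  have hf' : ∀ᵐ ξ : Space d, ξ ∉ cube d 1 → (𝓕 f : L2 d) ξ = 0 := hf
  filter_upwards [hf'] with ξ h h0
  exact abs_inner_le_of_mem_cube (by_contra fun hξ => h0 (h hξ)) ht

theorem exists_mem_cube (t : Space d) : ∃ ρ : ℝ, 0 ≤ ρ ∧ t ∈ cube d ρ := by
  refine ⟨2 * ‖t‖, by positivity, fun i => ?_⟩
  rw [mul_div_cancel_left₀ _ (two_ne_zero), Set.mem_Icc, ← abs_le]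
  exact PiLp.norm_apply_le t i

theorem taylorTerm_smul (F : Space d → ℂ) (x t : Space d) (s : ℝ) (n : ℕ) :
    taylorTerm F x (s • t) n = (s : ℂ) ^ n * taylorTerm F x t n := by
  rw [taylorTerm, taylorTerm, mul_left_comm, ← integral_const_mul ((s : ℂ) ^ n)]
  congr 1
  refine integral_congr_ae (Filter.Eventually.of_forall fun ξ => ?_)
  simp only [inner_smul_right, Complex.ofReal_mul, mul_pow]
  ring

/-- A band-limited function that vanishes near a point vanishes identically. -/
theorem eq_zero_of_eventually_value_eq_zero {f : L2 d} (hf : f ∈ bandlimited d) {x : Space d}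
    (hx : ∀ᶠ y in nhds x, value f y = 0) : f = 0 := by
  have hval : ∀ y, value f y = 0 := fun y => by
    set t := y - x with ht
    set F : Space d → ℂ := ⇑(𝓕 f : L2 d) with hF
    have hs : ∀ s : ℝ,
        HasSum (fun n => (s : ℂ) ^ n * taylorTerm F x t n) (value f (x + s • t)) := by
      intro s
      obtain ⟨ρ, -, hρ⟩ := exists_mem_cube (s • t)
      refine (hasSum_taylorTerm (integrable_fourier hf) x (s • t)
        (ae_abs_inner_le hf hρ)).congr_fun ?_
      intro n
      rw [taylorTerm_smul]
    -- On the line from `x` to `y` the function is a power series in `s`, convergent for every real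
    -- `s`. Vanishing near `s = 0` kills all coefficients, and `s = 1` then gives the value at `y`.
    let p : FormalMultilinearSeries ℝ ℝ ℂ := fun n =>
      ContinuousMultilinearMap.mkPiRing ℝ (Fin n) (taylorTerm F x t n)
    have hp : HasFPowerSeriesAt (fun s : ℝ => value f (x + s • t)) p 0 := by
      rw [hasFPowerSeriesAt_iff]
      refine Filter.Eventually.of_forall fun s => ?_
      have := hs s
      simpa [p, FormalMultilinearSeries.coeff] using this
    have hp0 := hp.eq_zero_of_eventually (by
      have hc : Filter.Tendsto (fun s : ℝ => x + s • t) (nhds 0) (nhds x) := by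
        have : Continuous fun s : ℝ => x + s • t := by fun_prop
        simpa using this.tendsto 0
      exact hc.eventually hx)
    have hcoef : ∀ n, taylorTerm F x t n = 0 := fun n => by
      have h := congrArg (fun q : FormalMultilinearSeries ℝ ℝ ℂ => q n fun _ => 1) hp0
      simpa [p] using h
    have h1 := hs 1
    simp only [hcoef, mul_zero, one_smul] at h1
    have hxt : x + t = y := by rw [ht]; abel
    rw [hxt] at h1
    exact h1.unique hasSum_zero
  refine Lp.ext ?_
  filter_upwards [ae_eq_value hf, Lp.coeFn_zero ℂ 2 (volume : Measure (Space d))] with y hy h0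
  rw [hy, hval, h0, Pi.zero_apply]

end Value

/-! ### The Plancherel–Pólya inequality -/

section PlancherelPolya

variable {d : ℕ}

theorem memLp_indicator_cube {R : ℝ} {m : Space d → ℂ} (hm : Continuous m) {C : ℝ}
    (hC : ∀ x ∈ cube d R, ‖m x‖ ≤ C) : MemLp ((cube d R).indicator m) 2 := by
  have h : MemLp m 2 (volume.restrict (cube d R)) := by
    have : IsFiniteMeasure ((volume : Measure (Space d)).restrict (cube d R)) :=
      ⟨by
        rw [Measure.restrict_apply_univ, volume_cube]
        exact ENNReal.pow_lt_top ENNReal.ofReal_lt_top⟩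
    refine MemLp.of_bound hm.aestronglyMeasurable C ?_
    exact ae_restrict_of_forall_mem (measurableSet_cube d R) hC
  exact (memLp_indicator_iff_restrict (measurableSet_cube d R)).2 h

/-- The exponential `ξ ↦ e^{-2πi y·ξ}` on the unit cube. -/
noncomputable def expCube (y : Space d) : L2 d :=
  (memLp_indicator_cube (d := d) (R := 1)
    (m := fun ξ => Complex.exp (2 * Real.pi * inner ℝ ξ (-y) * Complex.I)) (by fun_prop)
    (fun ξ _ => (norm_exp_inner ξ (-y)).le)).toLp _

theorem expCube_ae (y : Space d) : expCube y =ᵐ[volume] (cube d 1).indicator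
    fun ξ => Complex.exp (2 * Real.pi * inner ℝ ξ (-y) * Complex.I) := MemLp.coeFn_toLp _

theorem conj_exp_inner (ξ y : Space d) :
    (starRingEnd ℂ) (Complex.exp (2 * Real.pi * inner ℝ ξ (-y) * Complex.I)) =
      Complex.exp (2 * Real.pi * inner ℝ ξ y * Complex.I) := by
  rw [← Complex.exp_conj]
  simp [inner_neg_right, Complex.conj_ofNat]

theorem inner_expCube (y : Space d) (g : L2 d) :
    inner ℂ (expCube y) g =
      ∫ ξ in cube d 1, Complex.exp (2 * Real.pi * inner ℝ ξ y * Complex.I) * g ξ := by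
  rw [L2.inner_def, ← integral_indicator (measurableSet_cube d 1)]
  refine integral_congr_ae ?_
  filter_upwards [expCube_ae y] with ξ h
  rw [h, RCLike.inner_apply]
  by_cases hξ : ξ ∈ cube d 1
  · rw [Set.indicator_of_mem hξ, Set.indicator_of_mem hξ, conj_exp_inner, mul_comm]
  · simp [hξ]

/-- The lattice point with integer coordinates `k`. -/
noncomputable def latticePoint (k : Fin d → ℤ) : Space d := WithLp.toLp 2 fun i => (k i : ℝ)

theorem integral_exp_int (m : ℤ) (hm : m ≠ 0) :
    ∫ s : ℝ, (Set.Icc (-(1 / 2)) (1 / 2)).indicator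
      (fun s : ℝ => Complex.exp (2 * Real.pi * (s * m) * Complex.I)) s = 0 := by
  rw [integral_indicator measurableSet_Icc, integral_Icc_eq_integral_Ioc,
    ← intervalIntegral.integral_of_le (by norm_num)]
  have hc : (2 * Real.pi * m * Complex.I : ℂ) ≠ 0 := by
    simp [hm, Real.pi_ne_zero]
  have h := integral_exp_mul_complex (a := -(1 / 2)) (b := 1 / 2) hc
  have he : Complex.exp (2 * Real.pi * m * Complex.I * ((1 / 2 : ℝ) : ℂ)) =
      Complex.exp (2 * Real.pi * m * Complex.I * ((-(1 / 2) : ℝ) : ℂ)) := by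
    rw [Complex.exp_eq_exp_iff_exists_int]
    refine ⟨m, ?_⟩
    push_cast
    ring
  rw [he, sub_self, zero_div] at h
  rw [← h]
  refine intervalIntegral.integral_congr fun s _ => ?_
  refine congrArg Complex.exp ?_
  ring

/-- The integrand, cut off to the cube, factors over the coordinates, and a coordinate with `k i ≠
0` contributes an integral over whole periods. -/
theorem integral_cube_exp_latticePoint {k : Fin d → ℤ} (hk : k ≠ 0) :
    ∫ ξ in cube d 1, Complex.exp (2 * Real.pi * inner ℝ ξ (latticePoint k) * Complex.I) = 0 := by
  rw [← integral_indicator (measurableSet_cube d 1),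
    ← (EuclideanSpace.volume_preserving_symm_measurableEquiv_toLp (Fin d)).symm.integral_comp']
  have h : ∀ v : Fin d → ℝ, (cube d 1).indicator
      (fun ξ => Complex.exp (2 * Real.pi * inner ℝ ξ (latticePoint k) * Complex.I))
        (WithLp.toLp 2 v) = ∏ i, (Set.Icc (-(1 / 2)) (1 / 2)).indicator
      (fun s : ℝ => Complex.exp (2 * Real.pi * (s * (k i)) * Complex.I)) (v i) := by
    intro v
    by_cases hv : WithLp.toLp 2 v ∈ cube d 1
    · rw [Set.indicator_of_mem hv]
      have : ∀ i, v i ∈ Set.Icc (-(1 / 2) : ℝ) (1 / 2) := fun i => hv i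
      simp only [Set.indicator_of_mem (this _)]
      rw [← Complex.exp_sum]
      congr 1
      simp only [PiLp.inner_apply, latticePoint]
      simp [Finset.mul_sum, mul_comm]
    · rw [Set.indicator_of_notMem hv]
      have : ∃ i, v i ∉ Set.Icc (-(1 / 2) : ℝ) (1 / 2) := by
        by_contra hcon
        push Not at hcon
        exact hv hcon
      obtain ⟨i, hi⟩ := this
      exact (Finset.prod_eq_zero (Finset.mem_univ i) (Set.indicator_of_notMem hi _)).symm
  obtain ⟨i, hi⟩ : ∃ i, k i ≠ 0 := by
    by_contra hcon
    push Not at hcon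
    exact hk (funext hcon)
  refine (integral_congr_ae (Filter.Eventually.of_forall h)).trans ?_
  rw [integral_fintype_prod_volume_eq_prod (fun i => (Set.Icc (-(1 / 2)) (1 / 2)).indicator
      (fun s : ℝ => Complex.exp (2 * Real.pi * (s * (k i)) * Complex.I)))]
  exact Finset.prod_eq_zero (Finset.mem_univ i) (integral_exp_int (k i) hi)

theorem orthonormal_expCube_latticePoint :
    Orthonormal ℂ fun k : Fin d → ℤ => expCube (latticePoint k) := by
  have key : ∀ k l : Fin d → ℤ, inner ℂ (expCube (latticePoint k)) (expCube (latticePoint l)) =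
      ∫ ξ in cube d 1,
        Complex.exp (2 * Real.pi * inner ℝ ξ (latticePoint (k - l)) * Complex.I) := by
    intro k l
    rw [inner_expCube]
    refine setIntegral_congr_ae (measurableSet_cube d 1) ?_
    filter_upwards [expCube_ae (latticePoint l)] with ξ h hξ
    rw [h, Set.indicator_of_mem hξ, ← Complex.exp_add]
    have : latticePoint (k - l) = latticePoint k + -latticePoint l := by
      ext i; simp [latticePoint, sub_eq_add_neg]
    rw [this, inner_add_right]
    congr 1
    push_cast
    ring
  rw [orthonormal_iff_ite]
  intro k l
  rw [key]
  split_ifs with h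
  · subst h
    have h0 : latticePoint (0 : Fin d → ℤ) = 0 := by ext i; simp [latticePoint]
    simp [h0]
  · exact integral_cube_exp_latticePoint (sub_ne_zero.2 h)

theorem norm_prod_coord_le {R : ℝ} {n : ℕ} (ι : Fin n → Fin d) {ξ : Space d}
    (hξ : ξ ∈ cube d R) : ‖∏ j, ((ξ (ι j) : ℝ) : ℂ)‖ ≤ (R / 2) ^ n := by
  rw [norm_prod]
  calc ∏ j, ‖((ξ (ι j) : ℝ) : ℂ)‖ ≤ ∏ _j : Fin n, R / 2 := by
        refine Finset.prod_le_prod (fun _ _ => norm_nonneg _) fun j _ => ?_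
        rw [Complex.norm_real]
        exact abs_le_of_mem_cube hξ _
    _ = (R / 2) ^ n := by rw [Finset.prod_const, Finset.card_univ, Fintype.card_fin]

/-- The monomial `ξ ↦ ∏ j, ξ (ι j)` on the unit cube. -/
noncomputable def cubeMonomial {n : ℕ} (ι : Fin n → Fin d) : Space d → ℂ :=
  (cube d 1).indicator fun ξ => ∏ j, ((ξ (ι j) : ℝ) : ℂ)

theorem norm_cubeMonomial_le {n : ℕ} (ι : Fin n → Fin d) (ξ : Space d) :
    ‖cubeMonomial ι ξ‖ ≤ (1 / 2) ^ n := by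
  rw [cubeMonomial]
  by_cases hξ : ξ ∈ cube d 1
  · rw [Set.indicator_of_mem hξ]
    exact norm_prod_coord_le ι hξ
  · rw [Set.indicator_of_notMem hξ, norm_zero]
    positivity

theorem memLp_cubeMonomial_mul {n : ℕ} (ι : Fin n → Fin d) (F : L2 d) :
    MemLp (fun ξ => cubeMonomial ι ξ * F ξ) 2 := by
  refine (Lp.memLp F).of_le_mul (c := (1 / 2) ^ n) ?_ (Filter.Eventually.of_forall fun ξ => ?_)
  · refine AEStronglyMeasurable.mul ?_ (Lp.aestronglyMeasurable F)
    refine AEStronglyMeasurable.indicator ?_ (measurableSet_cube d 1)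
    exact Continuous.aestronglyMeasurable (by fun_prop)
  · rw [norm_mul]
    gcongr
    exact norm_cubeMonomial_le ι ξ

/-- The product of a square integrable function and a monomial on the unit cube. -/
noncomputable def monomialMul {n : ℕ} (ι : Fin n → Fin d) (F : L2 d) : L2 d :=
  (memLp_cubeMonomial_mul ι F).toLp _

theorem monomialMul_ae {n : ℕ} (ι : Fin n → Fin d) (F : L2 d) :
    monomialMul ι F =ᵐ[volume] fun ξ => cubeMonomial ι ξ * F ξ := MemLp.coeFn_toLp _

theorem norm_monomialMul_le {n : ℕ} (ι : Fin n → Fin d) (F : L2 d) :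
    ‖monomialMul ι F‖ ≤ (1 / 2) ^ n * ‖F‖ := by
  refine Lp.norm_le_mul_norm_of_ae_le_mul ?_
  filter_upwards [monomialMul_ae ι F] with ξ h
  rw [h, norm_mul]
  gcongr
  exact norm_cubeMonomial_le ι ξ

theorem inner_monomialMul_left {n : ℕ} (ι : Fin n → Fin d) (F G : L2 d) :
    inner ℂ (monomialMul ι F) G = inner ℂ F (monomialMul ι G) := by
  rw [L2.inner_def, L2.inner_def]
  refine integral_congr_ae ?_
  filter_upwards [monomialMul_ae ι F, monomialMul_ae ι G] with ξ h1 h2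
  have hconj : (starRingEnd ℂ) (cubeMonomial ι ξ) = cubeMonomial ι ξ := by
    rw [cubeMonomial]
    by_cases hξ : ξ ∈ cube d 1 <;> simp [hξ, map_prod]
  rw [h1, h2, RCLike.inner_apply, RCLike.inner_apply, map_mul, hconj]
  ring

/-- Expanding `(ξ·t)^n` over `ι : Fin n → Fin d` separates the displacement `t` from the frequency
`ξ`. What depends on `x` is an inner product with an exponential, ready for Bessel's inequality; at
`x = 0` the separation shows finite rank. -/
theorem taylorTerm_eq_sum {F : L2 d} (hF : ∀ᵐ ξ, ξ ∉ cube d 1 → F ξ = 0) (x t : Space d)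
    (n : ℕ) : taylorTerm F x t n = (2 * Real.pi * Complex.I) ^ n / n.factorial *
      ∑ ι : Fin n → Fin d, (∏ j, ((t (ι j) : ℝ) : ℂ)) *
        inner ℂ (expCube x) (monomialMul ι F) := by
  rw [taylorTerm]
  congr 1
  have hint : ∀ ι : Fin n → Fin d, Integrable (fun ξ =>
      Complex.exp (2 * Real.pi * inner ℝ ξ x * Complex.I) * monomialMul ι F ξ)
      (volume.restrict (cube d 1)) := fun ι => by
    refine (integrable_exp_mul (integrable_of_vanishing ?_) x).restrict
    filter_upwards [monomialMul_ae ι F] with ξ h hξ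
    rw [h, cubeMonomial, Set.indicator_of_notMem hξ, zero_mul]
  simp only [inner_expCube, ← integral_const_mul]
  rw [← integral_finsetSum _ fun ι _ => (hint ι).const_mul _]
  rw [← setIntegral_eq_integral_of_ae_compl_eq_zero (s := cube d 1)]
  · refine setIntegral_congr_ae (measurableSet_cube d 1) ?_
    filter_upwards [ae_all_iff.2 fun ι : Fin n → Fin d => monomialMul_ae ι F] with ξ h hξ
    have hin : ((inner ℝ ξ t : ℝ) : ℂ) = ∑ i, (ξ i : ℂ) * (t i : ℂ) := by
      simp [PiLp.inner_apply, mul_comm]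
    rw [hin, Fintype.sum_pow, Finset.sum_mul]
    refine Finset.sum_congr rfl fun ι _ => ?_
    rw [h, cubeMonomial, Set.indicator_of_mem hξ, Finset.prod_mul_distrib]
    ring
  · filter_upwards [hF] with ξ h hξ
    rw [h hξ, mul_zero, mul_zero]

/-- Bessel's inequality for lattice points with bounded multiplicity. -/
theorem sum_norm_inner_expCube_le (Y : Finset (Space d)) (k : Space d → Fin d → ℤ) (N₀ : ℕ)
    (hk : ∀ l, (Y.filter fun y => k y = l).card ≤ N₀) (G : L2 d) :
    ∑ y ∈ Y, ‖inner ℂ (expCube (latticePoint (k y))) G‖ ^ 2 ≤ N₀ * ‖G‖ ^ 2 := by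
  rw [Finset.sum_comp (fun l => ‖inner ℂ (expCube (latticePoint l)) G‖ ^ 2) k]
  calc _ ≤ ∑ l ∈ Y.image k, (N₀ : ℝ) * ‖inner ℂ (expCube (latticePoint l)) G‖ ^ 2 := by
        refine Finset.sum_le_sum fun l _ => ?_
        rw [nsmul_eq_mul]
        gcongr
        exact hk l
    _ ≤ N₀ * ‖G‖ ^ 2 := by
        rw [← Finset.mul_sum]
        gcongr
        exact orthonormal_expCube_latticePoint.sum_inner_products_le G

/-- The vector of samples is expanded in `ℂ^Y`, each point about its own lattice point. Minkowski's
inequality sums the orders `n` and the indices `ι`, while Bessel controls each single `ι`. -/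
theorem sum_norm_value_sq_le {f : L2 d} (hf : f ∈ bandlimited d) (Y : Finset (Space d)) (N₀ : ℕ)
    (k : Space d → Fin d → ℤ) (hk : ∀ y, y - latticePoint (k y) ∈ cube d 1)
    (hN : ∀ l, (Y.filter fun y => k y = l).card ≤ N₀) :
    ∑ y ∈ Y, ‖value f y‖ ^ 2 ≤ Real.exp (d * Real.pi) * N₀ * ‖f‖ ^ 2 := by
  set F : L2 d := 𝓕 f with hF
  have hF0 : ∀ᵐ ξ : Space d, ξ ∉ cube d 1 → F ξ = 0 := hf
  let w : ℕ → EuclideanSpace ℂ Y := fun n => WithLp.toLp 2 fun y =>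
    taylorTerm F (latticePoint (k y)) (y - latticePoint (k y)) n
  let v : EuclideanSpace ℂ Y := WithLp.toLp 2 fun y => value f y
  let u : ∀ n : ℕ, (Fin n → Fin d) → EuclideanSpace ℂ Y := fun n ι => WithLp.toLp 2 fun y =>
    (∏ j, (((y - latticePoint (k y)) (ι j) : ℝ) : ℂ)) *
        inner ℂ (expCube (latticePoint (k y))) (monomialMul ι F)
  -- One factor `(1/2)^n` bounds the monomial in the displacement, the other the monomial in the
  -- frequency.
  have hu : ∀ n ι, ‖u n ι‖ ≤ (1 / 2) ^ n * (√N₀ * ((1 / 2) ^ n * ‖f‖)) := by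
    intro n ι
    rw [EuclideanSpace.norm_eq]
    refine Real.sqrt_le_iff.2 ⟨by positivity, ?_⟩
    calc ∑ y : Y, ‖u n ι y‖ ^ 2 ≤ ∑ y : Y, ((1 / 2) ^ n) ^ 2 *
          ‖inner ℂ (expCube (latticePoint (k y))) (monomialMul ι F)‖ ^ 2 := by
          refine Finset.sum_le_sum fun y _ => ?_
          rw [← mul_pow]
          change ‖_ * _‖ ^ 2 ≤ _
          rw [norm_mul]
          gcongr
          exact norm_prod_coord_le ι (hk y)
      _ = ((1 / 2) ^ n) ^ 2 * ∑ y ∈ Y,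
          ‖inner ℂ (expCube (latticePoint (k y))) (monomialMul ι F)‖ ^ 2 := by
          rw [← Finset.mul_sum, Finset.sum_coe_sort Y fun y =>
            ‖inner ℂ (expCube (latticePoint (k y))) (monomialMul ι F)‖ ^ 2]
      _ ≤ ((1 / 2) ^ n) ^ 2 * (N₀ * ((1 / 2) ^ n * ‖f‖) ^ 2) := by
          gcongr
          refine (sum_norm_inner_expCube_le Y k N₀ hN _).trans ?_
          gcongr
          exact (norm_monomialMul_le ι F).trans_eq (by rw [hF, Lp.norm_fourier_eq])
      _ = _ := by
          rw [mul_pow _ (√N₀ * _), mul_pow √_, Real.sq_sqrt (Nat.cast_nonneg _)]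
  -- There are `d^n` indices `ι`, and `2π · d · (1/2) · (1/2) = dπ/2`. Summing over `n` gives
  -- `e^{dπ/2}`, whose square is the final constant.
  have hw : ∀ n, ‖w n‖ ≤ (d * Real.pi / 2) ^ n / n.factorial * (√N₀ * ‖f‖) := by
    intro n
    have h : w n = ((2 * Real.pi * Complex.I) ^ n / (n.factorial : ℂ)) • ∑ ι, u n ι := by
      ext y
      change taylorTerm _ _ _ _ = _
      rw [taylorTerm_eq_sum hF0, PiLp.smul_apply, smul_eq_mul]
      simp [u, WithLp.ofLp_sum, Finset.sum_apply]
    rw [h, norm_smul, norm_two_pi_I_pow_div_factorial]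
    calc _ ≤ (2 * Real.pi) ^ n / n.factorial *
          ∑ _ι : Fin n → Fin d, (1 / 2) ^ n * (√N₀ * ((1 / 2) ^ n * ‖f‖)) := by
          gcongr
          exact (norm_sum_le _ _).trans (Finset.sum_le_sum fun ι _ => hu n ι)
      _ = _ := by
          rw [Finset.sum_const, Finset.card_univ, Fintype.card_fun, Fintype.card_fin,
            Fintype.card_fin, nsmul_eq_mul]
          have : (d * Real.pi / 2) ^ n =
              (2 * Real.pi) ^ n * (d : ℝ) ^ n * ((1 / 2) ^ n * (1 / 2) ^ n) := by
            rw [← mul_pow, ← mul_pow, ← mul_pow]; congr 1; ring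
          rw [this]
          push_cast
          ring
  have hsum : HasSum w v := by
    have h : HasSum (fun n => WithLp.ofLp (w n)) (WithLp.ofLp v) := by
      rw [Pi.hasSum]
      intro y
      have := hasSum_taylorTerm (integrable_fourier hf) (latticePoint (k y))
        (y - latticePoint (k y)) (ae_abs_inner_le hf (hk y))
      rw [add_sub_cancel] at this
      exact this
    exact h.map (WithLp.linearEquiv 2 ℂ (Y → ℂ)).symm (PiLp.continuous_toLp 2 _)
  have hexp : HasSum (fun n : ℕ => (d * Real.pi / 2) ^ n / n.factorial * (√N₀ * ‖f‖))
      (Real.exp (d * Real.pi / 2) * (√N₀ * ‖f‖)) := by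
    rw [Real.exp_eq_exp_ℝ]
    exact (NormedSpace.expSeries_div_hasSum_exp (d * Real.pi / 2)).mul_right _
  have hv : ‖v‖ ≤ Real.exp (d * Real.pi / 2) * (√N₀ * ‖f‖) := by
    rw [← hsum.tsum_eq]
    exact tsum_of_norm_bounded hexp hw
  calc ∑ y ∈ Y, ‖value f y‖ ^ 2 = ‖v‖ ^ 2 := by
        rw [EuclideanSpace.norm_sq_eq, ← Finset.sum_coe_sort]
    _ ≤ (Real.exp (d * Real.pi / 2) * (√N₀ * ‖f‖)) ^ 2 := by gcongr
    _ = _ := by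
        rw [mul_pow, mul_pow, Real.sq_sqrt (Nat.cast_nonneg _), ← Real.exp_nat_mul]
        have : ((2 : ℕ) : ℝ) * (d * Real.pi / 2) = d * Real.pi := by push_cast; ring
        rw [this]; ring

theorem exists_latticePoint (d : ℕ) :
    ∃ k : Space d → Fin d → ℤ, ∀ y, y - latticePoint (k y) ∈ cube d 1 :=
  ⟨fun y i => round (y i), fun y i => abs_le.1 (abs_sub_round (y i))⟩

theorem isPlancherelPolyaConst_exp (d : ℕ) :
    IsPlancherelPolyaConst d (Real.exp (d * Real.pi)) := by
  refine ⟨Real.exp_pos _, fun X N₀ hX f hf => ?_⟩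
  obtain ⟨k, hk⟩ := exists_latticePoint d
  have key : ∀ u : Finset X, ∑ x ∈ u, ‖value f x‖ ^ 2 ≤
      Real.exp (d * Real.pi) * N₀ * ‖f‖ ^ 2 := by
    intro u
    have h := sum_norm_value_sq_le hf (u.map (Function.Embedding.subtype _)) N₀ k hk (by
      intro l
      have h1 : (X ∩ latticeCube l).encard ≤ N₀ :=
        hX ▸ le_iSup (fun k : Fin d → ℤ => (X ∩ latticeCube k).encard) l
      -- Points assigned to `l` lie in the cube centred at `l`, so the covering index bounds the
      -- multiplicity.
      have h2 : (((u.map (Function.Embedding.subtype _)).filter fun y => k y = l :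
          Finset (Space d)) : Set (Space d)) ⊆ X ∩ latticeCube l := by
        intro y hy
        simp only [Finset.coe_filter, Finset.mem_map, Function.Embedding.subtype_apply,
          Set.mem_ofPred_eq] at hy
        obtain ⟨⟨x, -, rfl⟩, rfl⟩ := hy
        exact ⟨x.2, fun i => hk x i⟩
      have h3 := (Set.encard_le_encard h2).trans h1
      rw [Set.encard_coe_eq_coe_finsetCard] at h3
      exact_mod_cast h3)
    rwa [Finset.sum_map] at h
  have hs : Summable fun x : X => ‖value f x‖ ^ 2 :=
    summable_of_sum_le (fun _ => by positivity) key
  exact ⟨hs, hs.tsum_le_of_sum_le key⟩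

end PlancherelPolya

/-! ### Compactness of `A_R` -/

section Compactness

variable {d : ℕ}

/-- The monomial `x ↦ ∏ j, x (ι j)` on the cube `[-R/2, R/2]^d`, as an element of `L²`. -/
noncomputable def monomialL2 (R : ℝ) {n : ℕ} (ι : Fin n → Fin d) : L2 d :=
  (memLp_indicator_cube (d := d) (R := R) (m := fun x => ∏ j, ((x (ι j) : ℝ) : ℂ)) (by fun_prop)
    (fun _ hx => norm_prod_coord_le ι hx)).toLp _

theorem monomialL2_ae (R : ℝ) {n : ℕ} (ι : Fin n → Fin d) :
    monomialL2 R ι =ᵐ[volume] (cube d R).indicator fun x => ∏ j, ((x (ι j) : ℝ) : ℂ) :=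
  MemLp.coeFn_toLp _

/-- The `n`-th Taylor polynomial increment at the origin, restricted to `[-R/2, R/2]^d`, as a
finite rank operator. -/
noncomputable def taylorOp (d : ℕ) (R : ℝ) (n : ℕ) : L2 d →L[ℂ] L2 d :=
  ∑ ι : Fin n → Fin d, ((2 * Real.pi * Complex.I) ^ n / (n.factorial : ℂ)) •
    (innerSL ℂ (monomialMul ι (expCube 0)) ∘L
      ((Lp.fourierTransformₗᵢ (Space d) ℂ).toContinuousLinearEquiv : L2 d →L[ℂ] L2 d)).smulRight
      (monomialL2 R ι)

theorem isCompactOperator_smulRight {E : Type*} [NormedAddCommGroup E] [NormedSpace ℂ E]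
    (l : E →L[ℂ] ℂ) (v : E) : IsCompactOperator (l.smulRight v) := by
  have h : IsCompactOperator l := isCompactOperator_of_locallyCompactSpace_dom l
  exact h.clm_comp ((ContinuousLinearMap.id ℂ ℂ).smulRight v)

theorem isCompactOperator_smul {E : Type*} [NormedAddCommGroup E] [NormedSpace ℂ E]
    {T : E →L[ℂ] E} (hT : IsCompactOperator T) (c : ℂ) : IsCompactOperator (c • T : E →L[ℂ] E) :=
  IsCompactOperator.smul hT c

theorem isCompactOperator_sum {E ι : Type*} [NormedAddCommGroup E] [NormedSpace ℂ E]
    (s : Finset ι) (T : ι → E →L[ℂ] E) (h : ∀ i ∈ s, IsCompactOperator (T i)) :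
    IsCompactOperator (∑ i ∈ s, T i : E →L[ℂ] E) :=
  Finset.sum_induction T (fun S => IsCompactOperator S) (fun _ _ h₁ h₂ => h₁.add h₂)
    isCompactOperator_zero h

theorem isCompactOperator_taylorOp (d : ℕ) (R : ℝ) (n : ℕ) :
    IsCompactOperator (taylorOp d R n) :=
  isCompactOperator_sum _ _ fun _ _ => isCompactOperator_smul (isCompactOperator_smulRight _ _) _

theorem taylorOp_ae {R : ℝ} {f : L2 d} (hf : f ∈ bandlimited d) (n : ℕ) :
    taylorOp d R n f =ᵐ[volume]
      (cube d R).indicator fun x => taylorTerm (𝓕 f : L2 d) 0 x n := by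
  have h : taylorOp d R n f = ∑ ι : Fin n → Fin d,
      ((2 * Real.pi * Complex.I) ^ n / (n.factorial : ℂ) *
        inner ℂ (monomialMul ι (expCube 0)) (𝓕 f : L2 d)) • monomialL2 R ι := by
    rw [taylorOp, sum_apply]
    refine Finset.sum_congr rfl fun ι _ => ?_
    rw [mul_smul]
    rfl
  rw [h]
  filter_upwards [Lp.coeFn_fun_finsetSum Finset.univ fun ι : Fin n → Fin d =>
      ((2 * Real.pi * Complex.I) ^ n / (n.factorial : ℂ) *
        inner ℂ (monomialMul ι (expCube 0)) (𝓕 f : L2 d)) • monomialL2 R ι,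
    ae_all_iff.2 fun ι : Fin n → Fin d => Lp.coeFn_smul
      ((2 * Real.pi * Complex.I) ^ n / (n.factorial : ℂ) *
        inner ℂ (monomialMul ι (expCube 0)) (𝓕 f : L2 d)) (monomialL2 R ι),
    ae_all_iff.2 fun ι : Fin n → Fin d => monomialL2_ae R ι] with x h1 h2 h3
  rw [h1]
  simp only [h2, Pi.smul_apply, h3, smul_eq_mul]
  by_cases hx : x ∈ cube d R
  · simp only [Set.indicator_of_mem hx]
    rw [taylorTerm_eq_sum hf, Finset.mul_sum]
    refine Finset.sum_congr rfl fun ι _ => ?_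
    rw [inner_monomialMul_left]
    ring
  · simp [Set.indicator_of_notMem hx]

/-- The bound is a tail of an exponential series, uniform over the cube and over `f` in the unit
ball, so the truncations converge in operator norm. -/
theorem norm_value_sub_sum_le {R : ℝ} {f : L2 d} (hf : f ∈ bandlimited d) {x : Space d}
    (hx : x ∈ cube d R) (m : ℕ) :
    ‖value f x - ∑ n ∈ Finset.range m, taylorTerm (𝓕 f : L2 d) 0 x n‖ ≤
      (∑' n, (2 * Real.pi * (d * R / 4)) ^ (n + m) / (n + m).factorial) * ‖f‖ := by
  have h := hasSum_taylorTerm (integrable_fourier hf) 0 x (ae_abs_inner_le hf hx)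
  rw [zero_add] at h
  have h1 := (hasSum_nat_add_iff' m).2 h
  have hs : Summable fun n : ℕ => (2 * Real.pi * (d * R / 4)) ^ (n + m) / (n + m).factorial :=
    (summable_nat_add_iff m).2 (Real.summable_pow_div_factorial (2 * Real.pi * (d * R / 4)))
  change ‖𝓕⁻ (⇑(𝓕 f : L2 d) : Space d → ℂ) x - _‖ ≤ _
  rw [← h1.tsum_eq]
  refine tsum_of_norm_bounded (hs.hasSum.mul_right ‖f‖) fun n => ?_
  -- No sign of `R` is assumed: for `d > 0` the existence of `x` in the cube forces `R ≥ 0`.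
  have hR : 0 ≤ d * R / 4 := by
    rcases Nat.eq_zero_or_pos d with rfl | hd
    · simp
    · have := (abs_nonneg _).trans (abs_le_of_mem_cube hx ⟨0, hd⟩)
      have : 0 ≤ R := by linarith
      positivity
  have hpi := Real.pi_pos
  refine (norm_taylorTerm_le (integrable_fourier hf) 0 x (ae_abs_inner_le hf hx) (n + m)).trans ?_
  gcongr
  exact integral_norm_fourier_le hf

theorem isCompactOperator_timeLimit_comp_bandLimit (d : ℕ) (R : ℝ) :
    IsCompactOperator (timeLimit d R ∘L bandLimit d) := by
  set ε : ℕ → ℝ := fun m =>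
    ∑' n, (2 * Real.pi * (d * R / 4)) ^ (n + m) / (n + m).factorial with hε
  have hε0 : Filter.Tendsto ε Filter.atTop (nhds 0) :=
    tendsto_sum_nat_add fun n => (2 * Real.pi * (d * R / 4)) ^ n / n.factorial
  have hvol : volume (cube d R) ≠ ⊤ := by
    rw [volume_cube]; exact ENNReal.pow_ne_top ENNReal.ofReal_ne_top
  set C : ℝ := (volume : Measure (Space d)).real (cube d R) ^ (1 / (2 : ℝ)) with hC
  have hC0 : 0 ≤ C := by positivity
  -- The uniform error on the cube becomes an `L²` error at the cost of the square root `C` of the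
  -- volume.
  have hbound : ∀ m, ‖((∑ n ∈ Finset.range m, taylorOp d R n) ∘L bandLimit d) -
      timeLimit d R ∘L bandLimit d‖ ≤ |ε m| * C := by
    intro m
    refine ContinuousLinearMap.opNorm_le_bound _ (by positivity) fun g => ?_
    have hg := bandLimit_mem g
    have h := Lp.norm_le_norm_of_ae_le
      (f := (∑ n ∈ Finset.range m, taylorOp d R n (bandLimit d g)) - timeLimit d R (bandLimit d g))
      (g := indicatorConstLp 2 (measurableSet_cube d R) hvol (|ε m| * ‖g‖)) (by
        filter_upwards [Lp.coeFn_sub (∑ n ∈ Finset.range m, taylorOp d R n (bandLimit d g))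
            (timeLimit d R (bandLimit d g)),
          Lp.coeFn_fun_finsetSum (Finset.range m) fun n => taylorOp d R n (bandLimit d g),
          ae_all_iff.2 fun n => taylorOp_ae (R := R) hg n,
          cutoff_ae (cube d R) (measurableSet_cube d R) (bandLimit d g), ae_eq_value hg,
          indicatorConstLp_coeFn (p := 2) (hs := measurableSet_cube d R) (hμs := hvol)
            (c := |ε m| * ‖g‖)] with x h1 h2 h3 h4 h5 h6
        rw [h1, Pi.sub_apply, h2, timeLimit, h4, h6]
        simp only [h3]
        by_cases hx : x ∈ cube d R
        · simp only [Set.indicator_of_mem hx]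
          rw [h5, norm_sub_rev]
          refine (norm_value_sub_sum_le hg hx m).trans ?_
          rw [norm_mul, norm_norm, Real.norm_eq_abs, abs_abs]
          gcongr
          · exact le_abs_self _
          · exact norm_bandLimit_le g
        · simp [Set.indicator_of_notMem hx])
    rw [norm_indicatorConstLp two_ne_zero ENNReal.ofNat_ne_top, norm_mul, norm_norm,
      Real.norm_eq_abs, abs_abs] at h
    have h' : (((∑ n ∈ Finset.range m, taylorOp d R n) ∘L bandLimit d) -
        timeLimit d R ∘L bandLimit d) g =
        (∑ n ∈ Finset.range m, taylorOp d R n (bandLimit d g)) - timeLimit d R (bandLimit d g) := by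
      simp
    rw [h']
    refine h.trans_eq ?_
    rw [hC, ENNReal.toReal_ofNat]
    ring
  refine isCompactOperator_of_tendsto (l := Filter.atTop)
    (F := fun m => (∑ n ∈ Finset.range m, taylorOp d R n) ∘L bandLimit d) ?_ ?_
  · rw [tendsto_iff_norm_sub_tendsto_zero]
    refine squeeze_zero (fun _ => norm_nonneg _) hbound ?_
    simpa using hε0.abs.mul_const C
  · exact Filter.Eventually.of_forall fun m =>
      (isCompactOperator_sum _ _ fun n _ => isCompactOperator_taylorOp d R n).comp_clm (bandLimit d)

theorem isCompactOperator_timeFreqLimit (d : ℕ) (R : ℝ) :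
    IsCompactOperator (timeFreqLimit d R) :=
  (isCompactOperator_timeLimit_comp_bandLimit d R).clm_comp (bandLimit d)

end Compactness

/-! ### Eigenvalues, projection onto `P_N`, and least squares -/

section Prolate

variable {d : ℕ}

theorem isClosed_cube (d : ℕ) (R : ℝ) : IsClosed (cube d R) := by
  have h : cube d R = ⋂ i, (fun x : Space d => x i) ⁻¹' Set.Icc (-(R / 2)) (R / 2) := by
    ext x; simp [cube]
  rw [h]
  exact isClosed_iInter fun i => isClosed_Icc.preimage (by fun_prop)

/-- No nonzero band-limited function is supported in a cube. -/
theorem eq_zero_of_timeLimit_eq_self (hd : 1 ≤ d) {R : ℝ} (hR : 0 < R) {g : L2 d}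
    (hg : g ∈ bandlimited d) (h : timeLimit d R g = g) : g = 0 := by
  have hae : value g =ᵐ[volume.restrict (cube d R)ᶜ] fun _ => 0 := by
    rw [Filter.EventuallyEq, ae_restrict_iff' (measurableSet_cube d R).compl]
    have h1 := cutoff_ae (cube d R) (measurableSet_cube d R) g
    rw [← timeLimit, h] at h1
    filter_upwards [h1, ae_eq_value hg] with x h1 h2 hx
    rw [← h2, h1, Set.indicator_of_notMem hx]
  -- A continuous function vanishing almost everywhere on an open set vanishes at every point of it.
  have hz := Measure.eqOn_open_of_ae_eq hae (isClosed_cube d R).isOpen_compl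
    (continuous_value hg).continuousOn continuousOn_const
  have hx : WithLp.toLp 2 (fun _ => R) ∈ (cube d R)ᶜ := fun hmem => by
    have := (hmem ⟨0, hd⟩).2
    simp only at this
    linarith
  exact eq_zero_of_eventually_value_eq_zero hg
    (Filter.eventually_of_mem ((isClosed_cube d R).isOpen_compl.mem_nhds hx) hz)

theorem mem_bandlimited_of_eigen {R : ℝ} {g : L2 d} {μ : ℂ} (hμ : μ ≠ 0)
    (h : timeFreqLimit d R g = μ • g) : g ∈ bandlimited d := by
  have : g = μ⁻¹ • timeFreqLimit d R g := by rw [h, inv_smul_smul₀ hμ]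
  rw [this]
  exact (bandlimited d).smul_mem _ (timeFreqLimit_mem R g)

theorem eigenvalue_mul_norm_sq {R : ℝ} {g : L2 d} {μ : ℂ} (hg : g ∈ bandlimited d)
    (h : timeFreqLimit d R g = μ • g) :
    μ * ((‖g‖ ^ 2 : ℝ) : ℂ) = ((‖timeLimit d R g‖ ^ 2 : ℝ) : ℂ) := by
  rw [← inner_timeFreqLimit_self hg, h, inner_smul_right, inner_self_eq_norm_sq_to_K]
  simp

/-- As `P_R` is an orthogonal projection, `‖P_R g - g‖² = ‖g‖² - ‖P_R g‖² = (1 - μ)‖g‖²`. If `μ ≥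
1`, then `g` is supported in the cube and so vanishes. -/
theorem eigenvalue_lt_one (hd : 1 ≤ d) {R : ℝ} (hR : 0 < R) {g : L2 d} {μ : ℝ} (hμ : 0 < μ)
    (hg : g ≠ 0) (h : timeFreqLimit d R g = (μ : ℂ) • g) : μ < 1 := by
  by_contra! hcon
  have hb := mem_bandlimited_of_eigen (Complex.ofReal_ne_zero.2 hμ.ne') h
  have h1 : μ * ‖g‖ ^ 2 = ‖timeLimit d R g‖ ^ 2 := by exact_mod_cast eigenvalue_mul_norm_sq hb h
  have h2 : ‖g‖ ^ 2 ≤ ‖timeLimit d R g‖ ^ 2 := by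
    rw [← h1]
    exact le_mul_of_one_le_left (by positivity) hcon
  have h3 : inner ℂ (timeLimit d R g) g = ((‖timeLimit d R g‖ ^ 2 : ℝ) : ℂ) := by
    rw [timeLimit, ← cutoff_cutoff, inner_cutoff_left, inner_self_eq_norm_sq_to_K, cutoff_cutoff]
    simp
  have h4 : ‖timeLimit d R g - g‖ ^ 2 ≤ 0 := by
    rw [norm_sub_sq (𝕜 := ℂ), h3, RCLike.re_to_complex, Complex.ofReal_re]
    linarith
  have h5 : timeLimit d R g - g = 0 := by
    rw [← norm_eq_zero]
    exact pow_eq_zero_iff two_ne_zero |>.1 (le_antisymm h4 (by positivity))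
  exact hg (eq_zero_of_timeLimit_eq_self hd hR hb (sub_eq_zero.1 h5))

variable {R : ℝ} {lam : ℕ → ℝ} {φ : ℕ → L2 d}

theorem IsProlateSystem.mem_bandlimited (hφ : IsProlateSystem d R lam φ) (j : ℕ) :
    φ j ∈ bandlimited d :=
  mem_bandlimited_of_eigen (Complex.ofReal_ne_zero.2 (hφ.pos j).ne') (hφ.eigen j)

theorem IsProlateSystem.prolateSpan_le (hφ : IsProlateSystem d R lam φ) (N : ℕ) :
    prolateSpan φ N ≤ bandlimited d := by
  rw [prolateSpan, Submodule.span_le]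
  rintro _ ⟨j, -, rfl⟩
  exact hφ.mem_bandlimited j

instance finiteDimensional_prolateSpan (φ : ℕ → L2 d) (N : ℕ) :
    FiniteDimensional ℂ (prolateSpan φ N) :=
  FiniteDimensional.span_of_finite ℂ ((Set.finite_lt_nat N).image φ)

theorem IsProlateSystem.timeFreqLimit_mem_prolateSpan (hφ : IsProlateSystem d R lam φ) (N : ℕ)
    {p : L2 d} (hp : p ∈ prolateSpan φ N) : timeFreqLimit d R p ∈ prolateSpan φ N := by
  have h : prolateSpan φ N ≤ (prolateSpan φ N).comap (timeFreqLimit d R : L2 d →ₗ[ℂ] L2 d) := by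
    conv_lhs => rw [prolateSpan]
    rw [Submodule.span_le]
    rintro _ ⟨j, hj, rfl⟩
    change timeFreqLimit d R (φ j) ∈ prolateSpan φ N
    rw [hφ.eigen]
    exact Submodule.smul_mem _ _ (Submodule.subset_span ⟨j, hj, rfl⟩)
  exact h hp

theorem IsProlateSystem.timeFreqLimit_mem_orthogonal (hφ : IsProlateSystem d R lam φ) (N : ℕ)
    {g : L2 d} (hg : g ∈ (prolateSpan φ N)ᗮ) : timeFreqLimit d R g ∈ (prolateSpan φ N)ᗮ := by
  rw [Submodule.mem_orthogonal] at hg ⊢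
  intro p hp
  have := timeFreqLimit_isSymmetric d R p g
  exact this.symm.trans (hg _ (hφ.timeFreqLimit_mem_prolateSpan N hp))

/-- On the orthogonal complement of the first `N` eigenfunctions the quadratic form of `A_R` is
bounded by the `N`-th eigenvalue. -/
theorem IsProlateSystem.norm_inner_timeFreqLimit_le (hφ : IsProlateSystem d R lam φ) {N : ℕ}
    {g : L2 d} (hg : g ∈ (prolateSpan φ N)ᗮ) :
    ‖inner ℂ g (timeFreqLimit d R g)‖ ≤ lam (N - 1) * ‖g‖ ^ 2 := by
  refine norm_inner_le_of_eigenvalue_le (isCompactOperator_timeFreqLimit d R)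
    (timeFreqLimit_isSymmetric d R) (prolateSpan φ N)ᗮ
    (fun x hx => hφ.timeFreqLimit_mem_orthogonal N hx) (hφ.pos _).le ?_ hg
  intro μ x hx hx0 hμx
  by_cases hμ : μ = 0
  · simpa [hμ] using (hφ.pos _).le
  have h := eigenvalue_mul_norm_sq (mem_bandlimited_of_eigen hμ hμx) hμx
  have hn : 0 < ‖x‖ ^ 2 := by positivity
  -- The Rayleigh quotient shows that `μ` is real and nonnegative, so exhaustiveness, stated for
  -- positive reals, applies once `μ` exceeds the bound.
  have hr : μ = ((‖timeLimit d R x‖ ^ 2 / ‖x‖ ^ 2 : ℝ) : ℂ) := by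
    rw [Complex.ofReal_div, ← h, mul_div_cancel_right₀]
    exact Complex.ofReal_ne_zero.2 hn.ne'
  set r : ℝ := ‖timeLimit d R x‖ ^ 2 / ‖x‖ ^ 2 with hrdef
  have hr0 : 0 ≤ r := by positivity
  rw [hr, Complex.norm_real, Real.norm_of_nonneg hr0]
  by_contra! hlt
  have hmem := hφ.exhaustive r ((hφ.pos _).trans hlt)
    (Module.End.mem_eigenspace_iff.2 (hr ▸ hμx))
  have hsub : φ '' {j | lam j = r} ⊆ φ '' {j | j < N} := by
    refine Set.image_mono fun j hj => ?_
    by_contra hjN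
    -- Here `j ≥ N ≥ N - 1`; with truncated subtraction this also covers `N = 0`.
    have h1 : lam j ≤ lam (N - 1) := hφ.antitone (by simp only [Set.mem_ofPred_eq] at hjN; omega)
    have h2 : lam j = r := hj
    linarith
  have hxP : x ∈ prolateSpan φ N := Submodule.span_mono hsub hmem
  exact hx0 (Submodule.disjoint_def.1 (prolateSpan φ N).orthogonal_disjoint x hxP hx)

/-- The cross terms of the quadratic form vanish because `P_N` and `P_Nᗮ` are invariant; the
component in `P_N` needs only the trivial bound `‖P_R p‖ ≤ ‖p‖`. -/
theorem IsProlateSystem.norm_sub_starProjection_sq_le (hφ : IsProlateSystem d R lam φ) (N : ℕ)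
    {δ : ℝ} {f : L2 d} (hf : f ∈ essSupported d R δ) :
    (1 - lam (N - 1)) * ‖f - (prolateSpan φ N).starProjection f‖ ^ 2 ≤ δ * ‖f‖ ^ 2 := by
  set P := prolateSpan φ N with hP
  set p := P.starProjection f with hp
  have hpP : p ∈ P := P.starProjection_apply_mem f
  set g := f - p with hg
  have hgP : g ∈ Pᗮ := P.sub_starProjection_mem_orthogonal f
  have hfpg : f = p + g := by rw [hg]; abel
  have hsplit : inner ℂ f (timeFreqLimit d R f) =
      inner ℂ p (timeFreqLimit d R p) + inner ℂ g (timeFreqLimit d R g) := by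
    rw [hfpg, map_add, inner_add_left, inner_add_right, inner_add_right,
      Submodule.inner_right_of_mem_orthogonal hpP (hφ.timeFreqLimit_mem_orthogonal N hgP),
      Submodule.inner_left_of_mem_orthogonal (hφ.timeFreqLimit_mem_prolateSpan N hpP) hgP]
    ring
  have hnorm : ‖f‖ ^ 2 = ‖p‖ ^ 2 + ‖g‖ ^ 2 := by
    rw [hfpg, sq, sq, sq]
    exact norm_add_sq_eq_norm_sq_add_norm_sq_of_inner_eq_zero p g
      (Submodule.inner_right_of_mem_orthogonal hpP hgP)
  have h1 : (1 - δ) * ‖f‖ ^ 2 ≤ ‖timeLimit d R f‖ ^ 2 := by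
    rw [timeLimit, norm_cutoff_sq]
    exact hf.2
  have h2 : ‖timeLimit d R p‖ ^ 2 ≤ ‖p‖ ^ 2 := by
    gcongr
    exact norm_cutoff_le _ _ _
  rw [inner_timeFreqLimit_self hf.1, inner_timeFreqLimit_self (hφ.prolateSpan_le N hpP)] at hsplit
  have h3 := congrArg Complex.re hsplit
  rw [Complex.add_re, Complex.ofReal_re, Complex.ofReal_re] at h3
  have h4 := (Complex.re_le_norm _).trans (hφ.norm_inner_timeFreqLimit_le hgP)
  linarith

/-- Least squares problems for the values of band-limited functions in a finite-dimensional space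
are solvable. -/
theorem exists_isLeastSquaresFit (V : Submodule ℂ (L2 d)) [FiniteDimensional ℂ V]
    (hV : V ≤ bandlimited d) (X : Finset (Space d)) (f : L2 d) :
    ∃ p, IsLeastSquaresFit V X f p := by
  let ev : V →ₗ[ℂ] EuclideanSpace ℂ X :=
    (WithLp.linearEquiv 2 ℂ (X → ℂ)).symm.toLinearMap ∘ₗ LinearMap.pi fun x : X =>
      { toFun := fun p : V => value (p : L2 d) x
        map_add' := fun p q => by
          rw [Submodule.coe_add, value_add (hV p.2) (hV q.2)]
        map_smul' := fun c p => by
          rw [Submodule.coe_smul, value_smul, RingHom.id_apply, smul_eq_mul] }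
  let y : EuclideanSpace ℂ X := WithLp.toLp 2 fun x => value f x
  have herr : ∀ p : V, sampledError X f p = dist y (ev p) ^ 2 := fun p => by
    rw [dist_eq_norm, EuclideanSpace.norm_sq_eq, sampledError, ← Finset.sum_coe_sort]
    rfl
  -- The achievable sample vectors form a finite-dimensional, hence closed, subspace of `ℂ^X`, so a
  -- nearest point to the data exists.
  obtain ⟨w, hw, hmin⟩ :=
    (Submodule.closed_of_finiteDimensional (LinearMap.range ev)).exists_infDist_eq_dist
      ⟨0, Submodule.zero_mem _⟩ y
  obtain ⟨p, rfl⟩ := hw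
  refine ⟨p, p.2, fun q hq => ?_⟩
  rw [herr p, herr ⟨q, hq⟩, ← hmin]
  refine pow_le_pow_left₀ Metric.infDist_nonneg ?_ 2
  exact Metric.infDist_le_dist_of_mem ⟨⟨q, hq⟩, rfl⟩

theorem IsPlancherelPolyaConst.sampledError_le {κ : ℝ} (hκ : IsPlancherelPolyaConst d κ)
    {X : Finset (Space d)} {N₀ : ℕ} (hN₀ : coveringIndex (X : Set (Space d)) = N₀) {f p : L2 d}
    (hf : f ∈ bandlimited d) (hp : p ∈ bandlimited d) :
    sampledError X f p ≤ κ * N₀ * ‖f - p‖ ^ 2 := by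
  refine Eq.trans_le ?_ (hκ.2 X N₀ hN₀ (f - p) ((bandlimited d).sub_mem hf hp)).2
  rw [sampledError, Finset.tsum_subtype' X fun x => ‖value (f - p) x‖ ^ 2]
  simp only [value_sub hf hp]

end Prolate

end RelevantSampling

/-! ### The sampled error estimate -/

theorem mainTheorem6 (d : ℕ) (hd : 1 ≤ d) (R : ℝ) (hR : 0 < R) (δ : ℝ) (hδ : δ ∈ Set.Ioo (0 : ℝ) 1)
    (lam : ℕ → ℝ) (φ : ℕ → RelevantSampling.L2 d)
    (hφ : RelevantSampling.IsProlateSystem d R lam φ)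
    (N : ℕ) (hN : 1 ≤ N) (α : ℝ) (hα : α = lam (N - 1))
    (X : Finset (RelevantSampling.Space d))
    (hX : (X : Set (RelevantSampling.Space d)) ⊆ RelevantSampling.cube d R)
    (N₀ : ℕ) (hN₀ : RelevantSampling.coveringIndex (X : Set (RelevantSampling.Space d)) = N₀) :
    α < 1 ∧
    RelevantSampling.IsPlancherelPolyaConst d (Real.exp (d * Real.pi)) ∧
    ∀ κ : ℝ, RelevantSampling.IsPlancherelPolyaConst d κ →
      ∀ f ∈ RelevantSampling.essSupported d R δ,
        (∃ p, RelevantSampling.IsLeastSquaresFit (RelevantSampling.prolateSpan φ N) X f p) ∧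
        ∀ p, RelevantSampling.IsLeastSquaresFit (RelevantSampling.prolateSpan φ N) X f p →
          RelevantSampling.sampledError X f p ≤ N₀ * κ * (δ / (1 - α)) * ‖f‖ ^ 2 := by
  have hα1 : α < 1 := hα ▸ RelevantSampling.eigenvalue_lt_one hd hR (hφ.pos _)
    (hφ.orthonormal.ne_zero _) (hφ.eigen (N - 1))
  refine ⟨hα1, RelevantSampling.isPlancherelPolyaConst_exp d, fun κ hκ f hf =>
    ⟨RelevantSampling.exists_isLeastSquaresFit _ (hφ.prolateSpan_le N) X f, fun p hp => ?_⟩⟩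
  have hP := (RelevantSampling.prolateSpan φ N).starProjection_apply_mem f
  have hα0 : 0 < 1 - α := sub_pos.2 hα1
  have hproj : ‖f - (RelevantSampling.prolateSpan φ N).starProjection f‖ ^ 2 ≤
      δ / (1 - α) * ‖f‖ ^ 2 := by
    rw [div_mul_eq_mul_div, le_div_iff₀' hα0, hα]
    exact hφ.norm_sub_starProjection_sq_le N hf
  calc RelevantSampling.sampledError X f p
      ≤ RelevantSampling.sampledError X f
        ((RelevantSampling.prolateSpan φ N).starProjection f) := hp.2 _ hP
    _ ≤ κ * N₀ * ‖f - (RelevantSampling.prolateSpan φ N).starProjection f‖ ^ 2 :=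
      hκ.sampledError_le hN₀ hf.1 (hφ.prolateSpan_le N hP)
    _ ≤ κ * N₀ * (δ / (1 - α) * ‖f‖ ^ 2) := by
      have := hκ.1
      gcongr
    _ = N₀ * κ * (δ / (1 - α)) * ‖f‖ ^ 2 := by ring
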